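/- An infinite word $\mathbf u$ over $\{a,b\}$ is Sturmian if for every $n\ge 0$ it has exactly $n+1$ distinct factors of length $n$. The palindromic complexity $p^{al}_{\mathbf u}(n)$ is the number of distinct palindromic factors of $\mathbf u$ of length $n$. Let $\mathbf v$ be a Sturmian word over $\{a,b\}$ written in the form $$\mathbf v=a^{l_0}ba^{l+\epsilon_1}ba^{l+\epsilon_2}ba^{l+\epsilon_3}b\cdots,\qquad l_0,l\ge 0,\ \epsilon_i\in\{0,1\},$$ let $k_0$ be the largest integer $k$ such that $(a^lb)^k$ is a factor of $\mathbf v$, and put $n_0=k_0(l+1)$. Let $F$ be the cellular automaton of window length $l+1$ that maps the window $a^{l+1}$ to $a$ and every other window to $b$; that is, the $i$-th letter of $F(\mathbf v)$ is $a$ if $v_iv_{i+1}\cdots v_{i+l}=a^{l+1}$, and is $b$ otherwise. **Theorem.** For every integer $n\ge 0$: 1. If $n\le n_0-l$, then $p^{al}_{F(\mathbf v)}(n)=1$ if $n$ is even, and $2$ otherwise. 2. If $n_0-l<n\le n_0$, then - for $n_0$ even: $p^{al}_{F(\mathbf v)}(n)=1$ if $l$ and $n$ are both even, $2$ if $l$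 is odd, and $3$ otherwise (that is, if $l$ is even and $n$ is odd); - for $n_0$ odd: $p^{al}_{F(\mathbf v)}(n)=2$. 3. If $n>n_0$, then $p^{al}_{F(\mathbf v)}(n)=1$ if $n+l$ is even, and $2$ otherwise. -/

import Mathlib

namespace SturmianCA

/-- The binary alphabet `{a, b}`. -/
inductive Letter : Type
  | a : Letter
  | b : Letter
  deriving DecidableEq

/-- Infinite words over an alphabet `A`, indexed from `0`. -/
abbrev InfWord (A : Type) : Type := ℕ → A

/-- The finite word `u_i u_{i+1} ⋯ u_{i+n-1}`. -/
def window {A : Type} (u : InfWord A) (i n : ℕ) : List A :=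
  (List.range n).map (fun j => u (i + j))

/-- The set `L_n(u)` of factors of length `n` of `u`. -/
def factors {A : Type} (u : InfWord A) (n : ℕ) : Set (List A) :=
  {w | ∃ i : ℕ, w = window u i n}

/-- The finite word `w` is a factor of `u`. -/
def IsFactor {A : Type} (w : List A) (u : InfWord A) : Prop :=
  ∃ i : ℕ, w = window u i w.length

/-- The finite word `w` is a prefix of `u`. -/
def IsPrefixOf {A : Type} (w : List A) (u : InfWord A) : Prop :=
  w = window u 0 w.length

/-- The complexity function: the number of distinct factors of length `n`. -/
noncomputable def complexity {A : Type} (u : InfWord A) (n : ℕ) : ℕ :=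
  (factors u n).ncard

/-- The palindromic complexity function: the number of distinct palindromic factors of
length `n`. -/
noncomputable def palComplexity {A : Type} (u : InfWord A) (n : ℕ) : ℕ :=
  {w | w ∈ factors u n ∧ w.reverse = w}.ncard

/-- An infinite binary word is Sturmian if it has exactly `n + 1` factors of length `n`, for
every `n`. -/
def IsSturmian (u : InfWord Letter) : Prop :=
  ∀ n : ℕ, complexity u n = n + 1

/-- The finite power `x^n` of a letter. -/
def letterPow {A : Type} (x : A) (n : ℕ) : List A := List.replicate n x

/-- The finite power `w^k` of a finite word. -/
def wordPow {A : Type} (w : List A) (k : ℕ) : List A := (List.replicate k w).flatten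

/-- The infinite word `v` is the infinite product
`a^{l₀} b a^{l+ε₁} b a^{l+ε₂} b a^{l+ε₃} b ⋯`, i.e. all the finite partial products are prefixes
of `v`. Here the value `ε i` is the exponent correction usually denoted `ε_{i+1}`. -/
def HasBlockForm (v : InfWord Letter) (l₀ l : ℕ) (ε : ℕ → Fin 2) : Prop :=
  ∀ N : ℕ, IsPrefixOf
    (letterPow Letter.a l₀ ++ [Letter.b] ++
      (List.range N).flatMap
        (fun i => letterPow Letter.a (l + (ε i : ℕ)) ++ [Letter.b])) v

/-- The action on infinite words of the cellular automaton with local rule `f` of window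
length `r`. -/
def cellularAutomaton {A B : Type} (r : ℕ) (f : (Fin r → A) → B) (u : InfWord A) : InfWord B :=
  fun i => f (fun j : Fin r => u (i + (j : ℕ)))

/-- The local rule on words of length `l + 1` sending `a^{l+1}` to `a` and every other word
to `b`. -/
def localRule (l : ℕ) (w : Fin (l + 1) → Letter) : Letter :=
  if ∀ j, w j = Letter.a then Letter.a else Letter.b

/-- The infinite word `F(v)`, where `F` is the cellular automaton with rule `localRule l`. -/
def imageWord (l : ℕ) (v : InfWord Letter) : InfWord Letter :=
  cellularAutomaton (l + 1) (localRule l) v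

/-- `k₀` is the greatest exponent `k` such that `(a^l b)^k` is a factor of `v`. -/
def IsMaxBlockPower (v : InfWord Letter) (l k₀ : ℕ) : Prop :=
  IsGreatest {k : ℕ | IsFactor (wordPow (letterPow Letter.a l ++ [Letter.b]) k) v} k₀

end SturmianCA

namespace SturmianCA

/-! Each factor of length n of F(v) is the image of a factor of length n + l of v. Letters b of v
are more than l apart, so a block of l letters together with the image determines everything around
it (`Separated.eq_of_imageWord_eq`). A letter a in the image supplies such a block, namely a^l;
hence an image factor other than b^n has a single preimage among the factors of v. Since these are
closed under reversal, the palindromes other than b^n in F(v) correspond to the palindromes of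
length n + l in v whose image is not b^n.

The preimages of b^n are windows of (a^l b)^ω with a starting phase t ≤ l. Such a window occurs in v
iff t + n ≤ n₀, and is a palindrome iff l + 1 divides 2t + n. If T(n) counts the phases with both
properties, then p_F(n) + T(n) = p_v(n + l) + [n ≤ n₀] (`IsSturmian.palComplexity_imageWord`), where
p_v is 1 at even and 2 at odd lengths (`IsSturmian.palComplexity_eq`). For n ≤ n₀ - l the occurrence
condition is vacuous and T(n) counts the solutions of 2t ≡ -n mod l + 1; for n₀ - l < n ≤ n₀ it
leaves only 2t + n = n₀; beyond n₀ there is no phase.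

The facts on Sturmian words come from the complexity n + 1: each length has exactly one right
special factor, which forces balance (`IsSturmian.balanced`), and balance in turn gives closure
under reversal and the palindromic complexity. -/

instance : Finite Letter :=
  Finite.of_injective (fun c : Letter => decide (c = Letter.a)) (by
    intro c d h
    cases c <;> cases d <;> simp_all)

theorem Letter.ne_a_iff {c : Letter} : c ≠ Letter.a ↔ c = Letter.b := by
  cases c <;> simp

/-! ### Windows and factors -/

section Windows

variable {A : Type} {u u' : InfWord A}

@[simp] theorem length_window (u : InfWord A) (i n : ℕ) : (window u i n).length = n := by
  simp [window]

@[simp] theorem getElem_window (u : InfWord A) (i n j : ℕ) (h : j < (window u i n).length) :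
    (window u i n)[j] = u (i + j) := by
  simp [window]

theorem window_eq_window_iff {i i' n : ℕ} :
    window u i n = window u' i' n ↔ ∀ j < n, u (i + j) = u' (i' + j) := by
  simp [window]

theorem eq_window_iff {w : List A} {i n : ℕ} (hn : w.length = n) :
    w = window u i n ↔ ∀ (j : ℕ) (h : j < w.length), w[j] = u (i + j) := by
  constructor
  · intro h j hj
    simp [List.getElem_of_eq h hj]
  · intro h
    apply List.ext_getElem
    · simp [hn]
    · intro j h1 h2
      simp [h j h1]

theorem window_add (u : InfWord A) (i m n : ℕ) :
    window u i (m + n) = window u i m ++ window u (i + m) n := by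
  simp [window, List.range_add, Nat.add_assoc, Function.comp_def]

theorem window_succ (u : InfWord A) (i n : ℕ) :
    window u i (n + 1) = window u i n ++ [u (i + n)] := by
  rw [window_add]; simp [window]

theorem window_succ' (u : InfWord A) (i n : ℕ) :
    window u i (n + 1) = u i :: window u (i + 1) n := by
  rw [Nat.add_comm n 1, window_add]; simp [window]

theorem isFactor_window (u : InfWord A) (i n : ℕ) : IsFactor (window u i n) u :=
  ⟨i, by simp⟩

theorem mem_factors_iff {n : ℕ} {w : List A} :
    w ∈ factors u n ↔ IsFactor w u ∧ w.length = n := by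
  constructor
  · rintro ⟨i, rfl⟩
    exact ⟨isFactor_window _ _ _, by simp⟩
  · rintro ⟨⟨i, h⟩, rfl⟩
    exact ⟨i, h⟩

theorem isFactor_append {x y : List A} :
    IsFactor (x ++ y) u ↔
      ∃ i, x = window u i x.length ∧ y = window u (i + x.length) y.length := by
  constructor
  · rintro ⟨i, h⟩
    rw [List.length_append, window_add] at h
    exact ⟨i, List.append_inj h (by simp)⟩
  · rintro ⟨i, h1, h2⟩
    refine ⟨i, ?_⟩
    rw [List.length_append, window_add, ← h1, ← h2]

theorem IsFactor.of_append_left {x y : List A} (h : IsFactor (x ++ y) u) : IsFactor x u := by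
  obtain ⟨i, h, -⟩ := isFactor_append.1 h
  exact ⟨i, h⟩

theorem IsFactor.of_append_right {x y : List A} (h : IsFactor (x ++ y) u) : IsFactor y u := by
  obtain ⟨i, -, h⟩ := isFactor_append.1 h
  exact ⟨_, h⟩

theorem IsFactor.tail {c : A} {y : List A} (h : IsFactor (c :: y) u) : IsFactor y u :=
  IsFactor.of_append_right (x := [c]) h

theorem IsFactor.exists_append_singleton {x : List A} (h : IsFactor x u) :
    ∃ c, IsFactor (x ++ [c]) u := by
  obtain ⟨i, h⟩ := h
  refine ⟨u (i + x.length), i, ?_⟩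
  rw [List.length_append, List.length_singleton, window_succ, ← h]

end Windows

/-! ### Counting right extensions -/

/-- The words of length `n` in the language `X`. -/
def level (X : Set (List Letter)) (n : ℕ) : Set (List Letter) :=
  {w | w ∈ X ∧ w.length = n}

/-- The right special words of length `n` of the language `X`. -/
def rightSpecial (X : Set (List Letter)) (n : ℕ) : Set (List Letter) :=
  {w | w.length = n ∧ w ++ [Letter.a] ∈ X ∧ w ++ [Letter.b] ∈ X}

/-- The language of an infinite word. -/
def language (u : InfWord Letter) : Set (List Letter) :=
  {w | IsFactor w u}

theorem finite_level (X : Set (List Letter)) (n : ℕ) : (level X n).Finite :=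
  (List.finite_length_eq Letter n).subset fun _ h => h.2

theorem finite_rightSpecial (X : Set (List Letter)) (n : ℕ) : (rightSpecial X n).Finite :=
  (List.finite_length_eq Letter n).subset fun _ h => h.1

theorem factors_eq_level (u : InfWord Letter) (n : ℕ) : factors u n = level (language u) n := by
  ext w; exact mem_factors_iff

theorem complexity_eq (u : InfWord Letter) (n : ℕ) :
    complexity u n = (level (language u) n).ncard := by
  rw [complexity, factors_eq_level]

/-- Sorting by last letter turns this into |S_a| + |S_b| = |S_a ∪ S_b| + |S_a ∩ S_b|. -/
theorem ncard_level_succ (X : Set (List Letter)) (n : ℕ) :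
    (level X (n + 1)).ncard =
      {w : List Letter | w.length = n ∧ (w ++ [Letter.a] ∈ X ∨ w ++ [Letter.b] ∈ X)}.ncard +
        (rightSpecial X n).ncard := by
  set S : Letter → Set (List Letter) := fun c => {w | w.length = n ∧ w ++ [c] ∈ X} with hS
  have hfin : ∀ c, (S c).Finite := fun c =>
    (List.finite_length_eq Letter n).subset fun _ h => h.1
  have himg : ∀ c, ((fun w => w ++ [c]) '' S c).ncard = (S c).ncard := fun c =>
    Set.ncard_image_of_injective _ fun x y h => by simpa using h
  have h1 : level X (n + 1) =
      (fun w => w ++ [Letter.a]) '' S Letter.a ∪ (fun w => w ++ [Letter.b]) '' S Letter.b := by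
    ext w
    constructor
    · rintro ⟨hw, hl⟩
      rcases List.eq_nil_or_concat' w with rfl | ⟨x, c, rfl⟩
      · simp at hl
      · have hx : x.length = n := by simpa using hl
        cases c
        · exact Or.inl ⟨x, ⟨hx, hw⟩, rfl⟩
        · exact Or.inr ⟨x, ⟨hx, hw⟩, rfl⟩
    · rintro (⟨x, ⟨hx, hw⟩, rfl⟩ | ⟨x, ⟨hx, hw⟩, rfl⟩)
      · exact ⟨hw, by simp [hx]⟩
      · exact ⟨hw, by simp [hx]⟩
  have hdisj : Disjoint ((fun w => w ++ [Letter.a]) '' S Letter.a)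
      ((fun w => w ++ [Letter.b]) '' S Letter.b) := by
    rw [Set.disjoint_left]
    rintro _ ⟨x, -, rfl⟩ ⟨y, -, h⟩
    have h2 := congrArg List.getLast? h
    simp at h2
  have h2 : {w : List Letter | w.length = n ∧ (w ++ [Letter.a] ∈ X ∨ w ++ [Letter.b] ∈ X)} =
      S Letter.a ∪ S Letter.b := by
    ext w; simp only [hS, Set.mem_ofPred_eq, Set.mem_union]; tauto
  have h3 : rightSpecial X n = S Letter.a ∩ S Letter.b := by
    ext w; simp only [hS, rightSpecial, Set.mem_ofPred_eq, Set.mem_inter_iff]; tauto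
  rw [h1, Set.ncard_union_eq hdisj ((hfin _).image _) ((hfin _).image _), himg, himg, h2, h3,
    Set.ncard_union_add_ncard_inter _ _ (hfin _) (hfin _)]

theorem ncard_level_succ_le {X : Set (List Letter)} (hX : ∀ w c, w ++ [c] ∈ X → w ∈ X) (n : ℕ) :
    (level X (n + 1)).ncard ≤ (level X n).ncard + (rightSpecial X n).ncard := by
  rw [ncard_level_succ]
  gcongr
  · exact finite_level X n
  · rintro w ⟨h, h' | h'⟩
    · exact ⟨hX _ _ h', h⟩
    · exact ⟨hX _ _ h', h⟩

theorem complexity_succ (u : InfWord Letter) (n : ℕ) :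
    complexity u (n + 1) = complexity u n + (rightSpecial (language u) n).ncard := by
  rw [complexity_eq, complexity_eq, ncard_level_succ]
  congr 2
  ext w
  constructor
  · rintro ⟨h, h' | h'⟩
    · exact ⟨IsFactor.of_append_left h', h⟩
    · exact ⟨IsFactor.of_append_left h', h⟩
  · rintro ⟨h, h'⟩
    refine ⟨h', ?_⟩
    obtain ⟨c, hc⟩ := IsFactor.exists_append_singleton h
    cases c
    · exact Or.inl hc
    · exact Or.inr hc

theorem tail_mem_rightSpecial {u : InfWord Letter} {n : ℕ} {c : Letter} {w : List Letter}
    (h : c :: w ∈ rightSpecial (language u) (n + 1)) : w ∈ rightSpecial (language u) n :=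
  ⟨by simpa using h.1, IsFactor.tail h.2.1, IsFactor.tail h.2.2⟩

theorem rightSpecial_eq_empty_of_le {u : InfWord Letter} {m n : ℕ} (hmn : m ≤ n)
    (h : rightSpecial (language u) m = ∅) : rightSpecial (language u) n = ∅ := by
  induction n, hmn using Nat.le_induction with
  | base => exact h
  | succ n _ ih =>
    rw [Set.eq_empty_iff_forall_notMem] at ih ⊢
    rintro (_ | ⟨c, w⟩) hw
    · simpa using hw.1
    · exact ih w (tail_mem_rightSpecial hw)

theorem complexity_zero (u : InfWord Letter) : complexity u 0 = 1 := by
  rw [complexity, Set.ncard_eq_one]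
  refine ⟨[], ?_⟩
  ext w
  constructor
  · rintro ⟨i, rfl⟩; simp [window]
  · rintro rfl; exact ⟨0, by simp [window]⟩

/-- If the complexity is at most `n` for the length `n`, then it is bounded. -/
theorem exists_complexity_le_of_complexity_le {u : InfWord Letter} {n : ℕ}
    (h : complexity u n ≤ n) : ∃ C, ∀ m, complexity u m ≤ C := by
  have h1 : ∃ m, rightSpecial (language u) m = ∅ := by
    by_contra! hne
    have : ∀ m, m + 1 ≤ complexity u m := by
      intro m
      induction m with
      | zero => rw [complexity_zero]
      | succ m ih =>
        rw [complexity_succ]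
        have := (Set.ncard_pos (finite_rightSpecial (language u) m)).2 (hne m)
        omega
    have := this n
    omega
  obtain ⟨m, hm⟩ := h1
  have hmono : Monotone (complexity u) :=
    monotone_nat_of_le_succ fun k => by rw [complexity_succ]; omega
  refine ⟨complexity u m, fun k => ?_⟩
  rcases le_total k m with hk | hk
  · exact hmono hk
  · induction k, hk using Nat.le_induction with
    | base => exact le_rfl
    | succ k hk ih =>
      rw [complexity_succ, rightSpecial_eq_empty_of_le hk hm]
      simpa using ih

/-! ### Recurrence and right special factors of Sturmian words -/

namespace IsSturmian

variable {v : InfWord Letter}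

/-- A factor with no left extension occurs only as a prefix. Deleting the first letter of v then
loses it, so the complexity drops to at most |w| at length |w| and stays bounded; but the deletion
costs at most one factor per length. -/
theorem exists_cons (hv : IsSturmian v) {w : List Letter} (hw : IsFactor w v) :
    ∃ c, IsFactor (c :: w) v := by
  by_contra! hno
  set u : InfWord Letter := fun i => v (i + 1) with hu
  have hwin : ∀ i n, window u i n = window v (i + 1) n := fun i n => by
    rw [window_eq_window_iff]; intro j _; simp only [hu]; congr 1; omega
  have hsub : ∀ n, factors v n ⊆ insert (window v 0 n) (factors u n) := by
    rintro n _ ⟨_ | i, rfl⟩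
    · exact Or.inl rfl
    · exact Or.inr ⟨i, (hwin i n).symm⟩
  have hfin : ∀ n, (factors u n).Finite := fun n => by
    rw [factors_eq_level]; exact finite_level _ _
  have hge : ∀ n, n ≤ complexity u n := fun n => by
    have h1 := Set.ncard_le_ncard (hsub n) ((hfin n).insert _)
    have h2 := Set.ncard_insert_le (window v 0 n) (factors u n)
    have h3 := hv n
    unfold complexity at h3 ⊢
    omega
  have hle : complexity u w.length ≤ w.length := by
    have hlt : factors u w.length ⊂ factors v w.length := by
      refine ⟨?_, fun h => ?_⟩
      · rintro _ ⟨i, rfl⟩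
        exact ⟨i + 1, hwin _ _⟩
      · obtain ⟨i, hi⟩ := h (mem_factors_iff.2 ⟨hw, rfl⟩)
        apply hno (v i)
        refine ⟨i, ?_⟩
        rw [List.length_cons, window_succ', ← hwin, ← hi]
    have hf : (factors v w.length).Finite := by
      rw [factors_eq_level]; exact finite_level _ _
    have h1 := Set.ncard_lt_ncard hlt hf
    have h2 := hv w.length
    unfold complexity at h2 ⊢
    omega
  obtain ⟨C, hC⟩ := exists_complexity_le_of_complexity_le hle
  have := (hge (C + 1)).trans (hC (C + 1))
  omega

theorem exists_append (hv : IsSturmian v) {w : List Letter} (hw : IsFactor w v) (N : ℕ) :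
    ∃ x : List Letter, x.length = N ∧ IsFactor (x ++ w) v := by
  induction N with
  | zero => exact ⟨[], rfl, hw⟩
  | succ N ih =>
    obtain ⟨x, hx, h⟩ := ih
    obtain ⟨c, hc⟩ := hv.exists_cons h
    exact ⟨c :: x, by simp [hx], hc⟩

/-- Every factor of a Sturmian word occurs at arbitrarily large positions. -/
theorem exists_ge (hv : IsSturmian v) {w : List Letter} (hw : IsFactor w v) (N : ℕ) :
    ∃ i, N ≤ i ∧ w = window v i w.length := by
  obtain ⟨x, hx, h⟩ := hv.exists_append hw N
  obtain ⟨i, -, h⟩ := isFactor_append.1 h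
  exact ⟨_, by omega, h⟩

theorem exists_rightSpecial_eq (hv : IsSturmian v) (n : ℕ) :
    ∃ r, rightSpecial (language v) n = {r} := by
  rw [← Set.ncard_eq_one]
  have := complexity_succ v n
  rw [hv, hv] at this
  omega

end IsSturmian

/-! ### Balance -/

/-- A set of words is balanced if the numbers of letters `a` in two words of the same length
differ by at most one. -/
def Balanced (X : Set (List Letter)) : Prop :=
  ∀ x ∈ X, ∀ y ∈ X, x.length = y.length → x.count Letter.a ≤ y.count Letter.a + 1

theorem eq_of_count_take_eq {x y : List Letter} (hl : x.length = y.length)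
    (h : ∀ k, (x.take k).count Letter.a = (y.take k).count Letter.a) : x = y := by
  induction x generalizing y with
  | nil => exact (List.length_eq_zero_iff.1 hl.symm).symm
  | cons c x ih =>
    rcases y with _ | ⟨d, y⟩
    · simp at hl
    · have hcd : c = d := by
        have := h 1
        cases c <;> cases d <;> simp_all
      subst hcd
      congr 1
      apply ih (by simpa using hl)
      intro k
      have := h (k + 1)
      simpa [List.count_cons] using this

theorem exists_eq_cons_append_singleton {A : Type} {x : List A} (hx : 2 ≤ x.length) :
    ∃ c m d, x = c :: (m ++ [d]) := by
  rcases x with _ | ⟨c, x⟩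
  · simp at hx
  · rcases List.eq_nil_or_concat' x with rfl | ⟨m, d, rfl⟩
    · simp at hx
    · exact ⟨c, m, d, rfl⟩

/-- A factorial language that is not balanced contains `awa` and `bwb` for some palindrome `w`. -/
theorem exists_palindrome_of_not_balanced {X : Set (List Letter)}
    (hl : ∀ x y, x ++ y ∈ X → x ∈ X) (hr : ∀ x y, x ++ y ∈ X → y ∈ X) (hX : ¬ Balanced X) :
    ∃ w : List Letter, w.reverse = w ∧
      ∀ c : Letter, c :: (w ++ [c]) ∈ X := by
  classical
  have hex : ∃ n, ∃ x ∈ X, ∃ y ∈ X, x.length = n ∧ y.length = n ∧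
      y.count Letter.a + 2 ≤ x.count Letter.a := by
    unfold Balanced at hX
    push Not at hX
    obtain ⟨x, hx, y, hy, h1, h2⟩ := hX
    exact ⟨x.length, x, hx, y, hy, rfl, h1.symm, by omega⟩
  obtain ⟨n, ⟨x, hx, y, hy, hxn, hyn, hxy⟩, hleast⟩ : ∃ n, (∃ x ∈ X, ∃ y ∈ X, x.length = n ∧
      y.length = n ∧ y.count Letter.a + 2 ≤ x.count Letter.a) ∧ ∀ k < n, ¬ ∃ x ∈ X, ∃ y ∈ X,
      x.length = k ∧ y.length = k ∧ y.count Letter.a + 2 ≤ x.count Letter.a :=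
    ⟨Nat.find hex, Nat.find_spec hex, fun _ hk => Nat.find_min hex hk⟩
  clear hex
  have hmin : ∀ x ∈ X, ∀ y ∈ X, x.length = y.length → x.length < n →
      x.count Letter.a ≤ y.count Letter.a + 1 := by
    intro x hx y hy h1 h2
    by_contra hlt
    exact hleast _ h2 ⟨x, hx, y, hy, rfl, h1.symm, by omega⟩
  have hn2 : 2 ≤ n := by
    have := List.count_le_length (a := Letter.a) (l := x)
    omega
  -- By minimality of n each half has excess at most one, while the total excess is at least two:
  -- both halves have excess exactly one.
  have hsplit : ∀ x₁ x₂ y₁ y₂ : List Letter, x = x₁ ++ x₂ → y = y₁ ++ y₂ →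
      x₁.length = y₁.length → x₁ ≠ [] → x₂ ≠ [] →
      x₁.count Letter.a = y₁.count Letter.a + 1 ∧ x₂.count Letter.a = y₂.count Letter.a + 1 := by
    rintro x₁ x₂ y₁ y₂ rfl rfl h h1 h2
    have h1' := List.length_pos_of_ne_nil h1
    have h2' := List.length_pos_of_ne_nil h2
    simp only [List.length_append, List.count_append] at hxn hyn hxy
    have e1 := hmin _ (hl _ _ hx) _ (hl _ _ hy) h (by omega)
    have e2 := hmin _ (hr _ _ hx) _ (hr _ _ hy) (by omega) (by omega)
    omega
  obtain ⟨c, m, d, rfl⟩ := exists_eq_cons_append_singleton (x := x) (by omega)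
  obtain ⟨c', m', d', rfl⟩ := exists_eq_cons_append_singleton (x := y) (by omega)
  have hlen : m.length = m'.length := by simp at hxn hyn; omega
  obtain ⟨rfl, rfl⟩ : c = Letter.a ∧ c' = Letter.b := by
    have := (hsplit [c] (m ++ [d]) [c'] (m' ++ [d']) rfl rfl rfl (by simp) (by simp)).1
    revert this
    cases c <;> cases c' <;> simp
  obtain ⟨rfl, rfl⟩ : d = Letter.a ∧ d' = Letter.b := by
    have := (hsplit (Letter.a :: m) [d] (Letter.b :: m') [d'] rfl rfl (by simp [hlen]) (by simp)
      (by simp)).2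
    revert this
    cases d <;> cases d' <;> simp
  obtain rfl : m = m' := by
    apply eq_of_count_take_eq hlen
    intro k
    have := (hsplit (Letter.a :: m.take k) (m.drop k ++ [Letter.a]) (Letter.b :: m'.take k)
      (m'.drop k ++ [Letter.b]) (by simp [← List.append_assoc]) (by simp [← List.append_assoc])
      (by simp [hlen]) (by simp) (by simp)).1
    simpa using this
  refine ⟨m, ?_, fun c => by cases c <;> assumption⟩
  apply eq_of_count_take_eq (by simp)
  intro k
  -- A prefix z and a suffix z' of m of equal length are compared through az against z'b and z'a
  -- against bz, all shorter than n.
  have key : ∀ z z' t t' : List Letter, m = z ++ t → m = t' ++ z' → z.length = z'.length →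
      z'.count Letter.a = z.count Letter.a := by
    intro z z' t t' h1 h2 h3
    have hz : ∀ c : Letter, c :: (m ++ [c]) ∈ X → c :: z ∈ X := fun c h =>
      hl (c :: z) (t ++ [c]) (by rw [h1] at h; simpa using h)
    have hz' : ∀ c : Letter, c :: (m ++ [c]) ∈ X → z' ++ [c] ∈ X := fun c h =>
      hr (c :: t') (z' ++ [c]) (by rw [h2] at h; simpa using h)
    have h4 : z.length ≤ m.length := by rw [h1]; simp
    have hxn' : m.length + 2 = n := by simpa using hxn
    have e1 := hmin _ (hz _ hx) _ (hz' _ hy) (by simp [h3]) (by simp; omega)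
    have e2 := hmin _ (hz' _ hx) _ (hz _ hy) (by simp [h3]) (by simp; omega)
    simp at e1 e2
    omega
  rw [List.take_reverse, List.count_reverse]
  rcases le_total k m.length with hk | hk
  · exact key _ _ (m.drop k) (m.take (m.length - k)) (by simp) (by simp) (by simp; omega)
  · rw [Nat.sub_eq_zero_of_le hk, List.take_of_length_le hk, List.drop_zero]

/-- Let n = |w| + 1. The palindrome w keeps cw from starting anywhere in an occurrence of dwd. The n
+ 1 windows of length n starting there thus avoid the only right special factor, so two of them
coincide among the n remaining factors. Outside cw each window determines the next, so v becomes
periodic and never meets cw again, against recurrence. -/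
theorem IsSturmian.not_rightSpecial_cons {v : InfWord Letter} (hv : IsSturmian v)
    {w : List Letter} (hw : w.reverse = w) {c d : Letter} (hcd : c ≠ d)
    (hd : IsFactor (d :: (w ++ [d])) v)
    (hc : c :: w ∈ rightSpecial (language v) (w.length + 1)) : False := by
  obtain ⟨n, hn⟩ : ∃ n, n = w.length + 1 := ⟨_, rfl⟩
  rw [← hn] at hc
  obtain ⟨i, hi⟩ := hd
  obtain ⟨r, hr⟩ := hv.exists_rightSpecial_eq n
  obtain rfl : c :: w = r := by rw [hr] at hc; exact hc
  have hvi : ∀ j (hj : j < (d :: (w ++ [d])).length), (d :: (w ++ [d]))[j] = v (i + j) :=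
    (eq_window_iff rfl).1 hi
  have hvw : ∀ j (hj : j < w.length), v (i + 1 + j) = w[j] := by
    intro j hj
    have := hvi (j + 1) (by simp; omega)
    simp only [List.getElem_cons_succ, List.getElem_append_left hj] at this
    rw [this]; congr 1; omega
  have hv0 : v i = d := by simpa using (hvi 0 (by simp)).symm
  have hvn : v (i + n) = d := by
    have := hvi (w.length + 1) (by simp)
    simpa [hn] using this.symm
  have hpal : ∀ j (hj : j < w.length), w[w.length - 1 - j] = w[j] := by
    intro j hj
    have := List.getElem_of_eq hw (i := j) (by simpa using hj)
    simpa using this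
  have havoid : ∀ k ≤ n, window v (i + k) n ≠ c :: w := by
    intro k hk hkw
    rw [hn, window_succ'] at hkw
    obtain ⟨h1, h2⟩ := List.cons.inj hkw
    rcases Nat.eq_zero_or_pos k with rfl | hk0
    · exact hcd (by rw [← h1, ← hv0]; rfl)
    · rcases hk.lt_or_eq with hk | rfl
      -- An occurrence of cw at offset k puts c at index k - 1 of w and, by reading the final d of
      -- dwd, puts d at the mirror index |w| - k.
      · have h3 := (eq_window_iff rfl).1 h2.symm (w.length - k) (by omega)
        have e1 := hpal (k - 1) (by omega)
        have e2 := hvw (k - 1) (by omega)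
        have hidx : w.length - 1 - (k - 1) = w.length - k := by omega
        simp only [hidx] at e1
        rw [e1, ← e2] at h3
        apply hcd
        rw [← h1, ← hvn]
        convert h3 using 2 <;> omega
      · exact hcd (by rw [← h1, ← hvn])
  have hdet : ∀ p q, window v p n = window v q n → window v p n ≠ c :: w →
      window v (p + 1) n = window v (q + 1) n := by
    intro p q hpq hne
    have hlast : v (p + n) = v (q + n) := by
      by_contra hne'
      apply hne
      have : window v p n ∈ rightSpecial (language v) n := by
        have h1 : window v p n ++ [v (p + n)] ∈ language v :=
          window_succ v p n ▸ isFactor_window v p (n + 1)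
        have h2 : window v p n ++ [v (q + n)] ∈ language v :=
          hpq ▸ window_succ v q n ▸ isFactor_window v q (n + 1)
        refine ⟨by simp, ?_, ?_⟩
        · cases hp : v (p + n) <;> cases hq : v (q + n) <;> simp_all
        · cases hp : v (p + n) <;> cases hq : v (q + n) <;> simp_all
      rw [hr] at this
      exact this
    have : window v p (n + 1) = window v q (n + 1) := by
      rw [window_succ, window_succ, hpq, hlast]
    rw [window_succ', window_succ'] at this
    exact (List.cons.inj this).2
  have hcard : (factors v n \ {c :: w}).ncard < (Set.Icc 0 n).ncard := by
    rw [Set.ncard_sdiff_singleton_of_mem]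
    · have := hv n
      unfold complexity at this
      rw [this, Set.ncard_eq_toFinset_card']
      simp
    · exact mem_factors_iff.2 ⟨IsFactor.of_append_left hc.2.1, hc.1⟩
  have hfin : (factors v n \ {c :: w}).Finite := by
    rw [factors_eq_level]; exact (finite_level _ _).sdiff
  obtain ⟨p, q, hpq, hqn, heq⟩ : ∃ p q, p < q ∧ q ≤ n ∧
      window v (i + p) n = window v (i + q) n := by
    obtain ⟨p, hp, q, hq, hne, h⟩ := Set.exists_ne_map_eq_of_ncard_lt_of_maps_to hcard
      (f := fun k => window v (i + k) n)
      (fun k hk => ⟨⟨_, rfl⟩, havoid k hk.2⟩) hfin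
    rcases lt_or_gt_of_ne hne with hlt | hlt
    · exact ⟨p, q, hlt, hq.2, h⟩
    · exact ⟨q, p, hlt, hp.2, h.symm⟩
  have hper : ∀ k, ∃ k', p ≤ k' ∧ k' < q ∧ window v (i + p + k) n = window v (i + k') n := by
    intro k
    induction k with
    | zero => exact ⟨p, le_rfl, hpq, rfl⟩
    | succ k ih =>
      obtain ⟨k', h1, h2, h3⟩ := ih
      have h4 := hdet _ _ h3 (by rw [h3]; exact havoid k' (by omega))
      rcases (Nat.succ_le_of_lt h2).lt_or_eq with h5 | h5
      · exact ⟨k' + 1, by omega, h5, h4⟩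
      · refine ⟨p, le_rfl, hpq, ?_⟩
        rw [heq, ← h5]
        exact h4
  obtain ⟨j, hj, hjw⟩ := hv.exists_ge (IsFactor.of_append_left hc.2.1) (i + p)
  obtain ⟨k', -, h2, h3⟩ := hper (j - (i + p))
  rw [Nat.add_sub_cancel' hj] at h3
  exact havoid k' (by omega) (by rw [← h3]; rw [← hc.1]; exact hjw.symm)

theorem IsSturmian.balanced {v : InfWord Letter} (hv : IsSturmian v) :
    Balanced (language v) := by
  by_contra hX
  obtain ⟨w, hw, h⟩ := exists_palindrome_of_not_balanced
    (fun x y (h : IsFactor (x ++ y) v) => h.of_append_left)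
    (fun x y (h : IsFactor (x ++ y) v) => h.of_append_right) hX
  have hwr : w ∈ rightSpecial (language v) w.length :=
    ⟨rfl, IsFactor.tail (h Letter.a), IsFactor.tail (h Letter.b)⟩
  obtain ⟨r, hr⟩ := hv.exists_rightSpecial_eq (w.length + 1)
  obtain ⟨r₀, hr₀⟩ := hv.exists_rightSpecial_eq w.length
  have hrmem : r ∈ rightSpecial (language v) (w.length + 1) := by rw [hr]; rfl
  rcases r with _ | ⟨c, w'⟩
  · simpa using hrmem.1
  · have hw' := tail_mem_rightSpecial hrmem
    rw [hr₀] at hwr hw'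
    obtain rfl : w' = w := hw'.trans hwr.symm
    cases c
    · exact hv.not_rightSpecial_cons hw (by simp) (h Letter.b) hrmem
    · exact hv.not_rightSpecial_cons hw (by simp) (h Letter.a) hrmem


/-! ### Closure under reversal and palindromic complexity of Sturmian words -/

theorem exists_eq_append_cons_of_ne {A : Type} {x y : List A} (hl : x.length = y.length)
    (hne : x ≠ y) :
    ∃ s t z c d, c ≠ d ∧ x = s ++ c :: z ∧ y = t ++ d :: z := by
  induction x generalizing y with
  | nil => exact (hne (List.length_eq_zero_iff.1 hl.symm).symm).elim
  | cons c x ih =>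
    rcases y with _ | ⟨d, y⟩
    · simp at hl
    · by_cases hxy : x = y
      · subst hxy
        exact ⟨[], [], x, c, d, fun h => hne (by rw [h]), rfl, rfl⟩
      · obtain ⟨s, t, z, c', d', h1, rfl, rfl⟩ := ih (by simpa using hl) hxy
        exact ⟨c :: s, d :: t, z, c', d', h1, rfl, rfl⟩

theorem Balanced.not_mem {X : Set (List Letter)} (hX : Balanced X) {w : List Letter}
    (ha : Letter.a :: (w ++ [Letter.a]) ∈ X) (hb : Letter.b :: (w ++ [Letter.b]) ∈ X) : False := by
  have := hX _ ha _ hb (by simp)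
  simp at this

/-- Two distinct right special words differ just before their longest common suffix z, which yields
both aza and bzb. -/
theorem Balanced.ncard_rightSpecial_le {X : Set (List Letter)} (hX : Balanced X)
    (hr : ∀ x y, x ++ y ∈ X → y ∈ X) (n : ℕ) : (rightSpecial X n).ncard ≤ 1 := by
  rw [Set.ncard_le_one (finite_rightSpecial X n)]
  intro x hx y hy
  by_contra hne
  obtain ⟨s, t, z, c, d, hcd, rfl, rfl⟩ := exists_eq_append_cons_of_ne (hx.1.trans hy.1.symm) hne
  obtain ⟨-, hxa, hxb⟩ := hx
  obtain ⟨-, hya, hyb⟩ := hy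
  simp only [List.append_assoc, List.cons_append] at hxa hxb hya hyb
  cases c <;> cases d
  · exact hcd rfl
  · exact hX.not_mem (hr _ _ hxa) (hr _ _ hyb)
  · exact hX.not_mem (hr _ _ hya) (hr _ _ hxb)
  · exact hcd rfl

theorem Balanced.ncard_level_le {X : Set (List Letter)} (hX : Balanced X)
    (hl : ∀ x y, x ++ y ∈ X → x ∈ X) (hr : ∀ x y, x ++ y ∈ X → y ∈ X) (n : ℕ) :
    (level X n).ncard ≤ n + 1 := by
  induction n with
  | zero =>
    rw [zero_add, Set.ncard_le_one (finite_level X 0)]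
    intro x hx y hy
    rw [List.length_eq_zero_iff.1 hx.2, List.length_eq_zero_iff.1 hy.2]
  | succ n ih =>
    have h1 := ncard_level_succ_le (fun w c => hl w [c]) n
    have h2 := hX.ncard_rightSpecial_le hr n
    omega

namespace IsSturmian

variable {v : InfWord Letter}

/-- Adding all reversals keeps the language factorial and balanced, since reversal preserves letter
counts. It therefore still has at most n + 1 words of length n, so nothing was added. -/
theorem isFactor_reverse (hv : IsSturmian v) {w : List Letter} (hw : IsFactor w v) :
    IsFactor w.reverse v := by
  set X : Set (List Letter) := {w | IsFactor w v ∨ IsFactor w.reverse v} with hXdef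
  have hl : ∀ x y, x ++ y ∈ X → x ∈ X := by
    rintro x y (h | h)
    · exact Or.inl h.of_append_left
    · rw [List.reverse_append] at h
      exact Or.inr h.of_append_right
  have hr : ∀ x y, x ++ y ∈ X → y ∈ X := by
    rintro x y (h | h)
    · exact Or.inl h.of_append_right
    · rw [List.reverse_append] at h
      exact Or.inr h.of_append_left
  have hX : Balanced X := by
    have key : ∀ x ∈ X, ∃ x' ∈ language v, x'.length = x.length ∧
        x'.count Letter.a = x.count Letter.a := by
      rintro x (h | h)
      · exact ⟨x, h, rfl, rfl⟩
      · exact ⟨x.reverse, h, by simp, by simp⟩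
    intro x hx y hy hxy
    obtain ⟨x', hx', h1, h2⟩ := key x hx
    obtain ⟨y', hy', h3, h4⟩ := key y hy
    rw [← h2, ← h4]
    exact hv.balanced x' hx' y' hy' (by omega)
  have heq : level (language v) w.length = level X w.length := by
    apply Set.eq_of_subset_of_ncard_le _ _ (finite_level _ _)
    · exact fun x hx => ⟨Or.inl hx.1, hx.2⟩
    · rw [← complexity_eq, hv]
      exact hX.ncard_level_le hl hr _
  have : w.reverse ∈ level X w.length := ⟨Or.inr (by simpa using hw), by simp⟩
  rw [← heq] at this
  exact this.1

/-- If w is right special, the right special factor of the next length is cw for some c, and it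
extends by c. Otherwise w has only one right extension, and reversal makes it equal to the left one.
-/
theorem exists_palindromic_extension (hv : IsSturmian v) {w : List Letter} (hw : IsFactor w v)
    (hpal : w.reverse = w) : ∃ c : Letter, IsFactor (c :: (w ++ [c])) v := by
  by_cases hs : w ∈ rightSpecial (language v) w.length
  · obtain ⟨r, hr⟩ := hv.exists_rightSpecial_eq (w.length + 1)
    obtain ⟨r₀, hr₀⟩ := hv.exists_rightSpecial_eq w.length
    have hrmem : r ∈ rightSpecial (language v) (w.length + 1) := by rw [hr]; rfl
    rcases r with _ | ⟨c, w'⟩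
    · simpa using hrmem.1
    · have hw' := tail_mem_rightSpecial hrmem
      rw [hr₀] at hs hw'
      obtain rfl : w' = w := hw'.trans hs.symm
      refine ⟨c, ?_⟩
      cases c
      · exact hrmem.2.1
      · exact hrmem.2.2
  · obtain ⟨c, hc⟩ := hv.exists_cons hw
    obtain ⟨d, hd⟩ := hc.exists_append_singleton
    refine ⟨c, ?_⟩
    have h1 : IsFactor (w ++ [c]) v := by
      have := hv.isFactor_reverse hc
      rwa [List.reverse_cons, hpal] at this
    have h2 : IsFactor (w ++ [d]) v := IsFactor.tail hd
    by_cases hcd : c = d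
    · subst hcd
      exact hd
    · refine (hs ⟨rfl, ?_, ?_⟩).elim
      · cases c <;> cases d <;> simp_all [language]
      · cases c <;> cases d <;> simp_all [language]

/-- Stripping both end letters is onto by palindromic extension, and injective because balance
forbids awa and bwb together. -/
theorem palComplexity_add_two (hv : IsSturmian v) (n : ℕ) :
    palComplexity v (n + 2) = palComplexity v n := by
  have hdec : ∀ w : List Letter, w.length = n + 2 → w.reverse = w →
      ∃ c m, w = c :: (m ++ [c]) ∧ m.reverse = m ∧ m.length = n := by
    intro w hl hw
    obtain ⟨c, m, d, rfl⟩ := exists_eq_cons_append_singleton (x := w) (by omega)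
    simp only [List.reverse_cons, List.reverse_append, List.reverse_nil, List.nil_append,
      List.cons_append, List.cons.injEq] at hw
    obtain ⟨rfl, h⟩ := hw
    exact ⟨d, m, rfl, List.append_inj_left' h rfl, by simpa using hl⟩
  have himg : {w | w ∈ factors v n ∧ w.reverse = w} =
      (fun w => w.tail.dropLast) '' {w | w ∈ factors v (n + 2) ∧ w.reverse = w} := by
    ext w
    simp only [Set.mem_image, Set.mem_ofPred_eq, mem_factors_iff]
    constructor
    · rintro ⟨⟨hw, hl⟩, hpal⟩
      obtain ⟨c, hc⟩ := hv.exists_palindromic_extension hw hpal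
      exact ⟨c :: (w ++ [c]), ⟨⟨hc, by simp [hl]⟩, by simp [hpal]⟩, by simp⟩
    · rintro ⟨x, ⟨⟨hx, hl⟩, hpal⟩, rfl⟩
      obtain ⟨c, m, rfl, hm, hml⟩ := hdec x hl hpal
      refine ⟨⟨?_, by simpa using hml⟩, by simpa using hm⟩
      simpa using (IsFactor.tail hx).of_append_left
  unfold palComplexity
  rw [himg, Set.InjOn.ncard_image]
  rintro x ⟨hx, hxp⟩ y ⟨hy, hyp⟩ hxy
  rw [mem_factors_iff] at hx hy
  obtain ⟨c, m, rfl, -, -⟩ := hdec x hx.2 hxp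
  obtain ⟨d, m', rfl, -, -⟩ := hdec y hy.2 hyp
  obtain rfl : m = m' := by simpa using hxy
  cases c <;> cases d
  · rfl
  · exact (hv.balanced.not_mem hx.1 hy.1).elim
  · exact (hv.balanced.not_mem hy.1 hx.1).elim
  · rfl

/-- A Sturmian word has one palindromic factor of each even length and two of each odd length. -/
theorem palComplexity_eq (hv : IsSturmian v) (n : ℕ) :
    palComplexity v n = if Even n then 1 else 2 := by
  have hsmall : ∀ n ≤ 1, palComplexity v n = n + 1 := by
    intro n hn
    rw [← hv n, palComplexity, complexity]
    congr 1
    ext w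
    simp only [Set.mem_ofPred_eq, and_iff_left_iff_imp, mem_factors_iff]
    rintro ⟨-, h⟩
    rcases w with _ | ⟨c, _ | ⟨d, w⟩⟩
    · rfl
    · rfl
    · simp at h; omega
  induction n using Nat.twoStepInduction with
  | zero => simpa using hsmall 0 (by omega)
  | one => simpa using hsmall 1 le_rfl
  | more n ih _ =>
    rw [hv.palComplexity_add_two, ih]
    simp [Nat.even_add]

end IsSturmian

/-! ### Words with separated letters `b` and the cellular automaton -/

/-- Any two letters `b` of `u` are separated by at least `l` letters. -/
def Separated (l : ℕ) (u : InfWord Letter) : Prop :=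
  ∀ i j, i < j → u i = Letter.b → u j = Letter.b → i + l < j

/-- The periodic word `(a^l b)^ω`. -/
def periodicWord (l : ℕ) : InfWord Letter :=
  fun j => if (l + 1) ∣ j + 1 then Letter.b else Letter.a

theorem window_reverse_eq_window_iff {A : Type} {u u' : InfWord A} {i i' n : ℕ} :
    (window u i n).reverse = window u' i' n ↔
      ∀ j < n, u (i + (n - 1 - j)) = u' (i' + j) := by
  rw [eq_window_iff (by simp)]
  simp

theorem imageWord_eq_a_iff {l : ℕ} {u : InfWord Letter} {i : ℕ} :
    imageWord l u i = Letter.a ↔ ∀ k ≤ l, u (i + k) = Letter.a := by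
  unfold imageWord cellularAutomaton localRule
  split_ifs with h
  · simp only [true_iff]
    exact fun k hk => h ⟨k, by omega⟩
  · simp only [false_iff]
    exact fun h' => h fun j => h' j (by omega)

theorem Letter.eq_of_a_iff {c d : Letter} (h : c = Letter.a ↔ d = Letter.a) : c = d := by
  cases c <;> cases d <;> simp_all

theorem imageWord_eq_imageWord {l : ℕ} {u u' : InfWord Letter} {i i' : ℕ}
    (h : ∀ k ≤ l, u (i + k) = u' (i' + k)) : imageWord l u i = imageWord l u' i' := by
  apply Letter.eq_of_a_iff
  rw [imageWord_eq_a_iff, imageWord_eq_a_iff]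
  exact forall₂_congr fun k hk => by rw [h k hk]

namespace Separated

variable {l : ℕ} {u u' : InfWord Letter}

theorem eq_a (hu : Separated l u) {p q : ℕ} (hq : u q = Letter.b) (hne : p ≠ q)
    (h1 : p ≤ q + l) (h2 : q ≤ p + l) : u p = Letter.a := by
  by_contra h
  rw [← ne_eq, Letter.ne_a_iff] at h
  rcases lt_or_gt_of_ne hne with hlt | hlt
  · have := hu p q hlt h hq
    omega
  · have := hu q p hlt hq h
    omega

/-- If the block of l letters is all a, the image letter reveals the next letter; if it contains b,
separation forces the next letter to be a. -/
theorem right_aux (hu' : Separated l u') {p q : ℕ}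
    (h : ∀ k < l, u (p + k) = u' (q + k)) (hF : imageWord l u p = imageWord l u' q)
    (ha : u (p + l) = Letter.a) : u' (q + l) = Letter.a := by
  by_cases hall : ∀ k < l, u (p + k) = Letter.a
  · have h1 : imageWord l u p = Letter.a := imageWord_eq_a_iff.2 fun k hk => by
      rcases hk.lt_or_eq with hk | rfl
      · exact hall k hk
      · exact ha
    exact imageWord_eq_a_iff.1 (hF ▸ h1) l le_rfl
  · push Not at hall
    obtain ⟨k, hk, hne⟩ := hall
    rw [Letter.ne_a_iff, h k hk] at hne
    exact hu'.eq_a hne (by omega) (by omega) (by omega)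

theorem left_aux (hu' : Separated l u') {p q : ℕ}
    (h : ∀ k < l, u (p + 1 + k) = u' (q + 1 + k)) (hF : imageWord l u p = imageWord l u' q)
    (ha : u p = Letter.a) : u' q = Letter.a := by
  by_cases hall : ∀ k < l, u (p + 1 + k) = Letter.a
  · have h1 : imageWord l u p = Letter.a := imageWord_eq_a_iff.2 fun k hk => by
      rcases k with _ | k
      · exact ha
      · have := hall k (by omega)
        rwa [Nat.add_right_comm, Nat.add_assoc] at this
    exact imageWord_eq_a_iff.1 (hF ▸ h1) 0 (Nat.zero_le _)
  · push Not at hall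
    obtain ⟨k, hk, hne⟩ := hall
    rw [Letter.ne_a_iff, h k hk] at hne
    exact hu'.eq_a hne (by omega) (by omega) (by omega)

/-- The image under the cellular automaton together with one block of `l` letters determines a
word whose letters `b` are separated. -/
theorem eq_of_imageWord_eq (hu : Separated l u) (hu' : Separated l u') {i i' n t₀ : ℕ}
    (hF : ∀ j < n, imageWord l u (i + j) = imageWord l u' (i' + j)) (ht₀ : t₀ ≤ n)
    (hblock : ∀ k < l, u (i + t₀ + k) = u' (i' + t₀ + k)) :
    ∀ m < n + l, u (i + m) = u' (i' + m) := by
  have hleft : ∀ t < n, (∀ k < l, u (i + t + 1 + k) = u' (i' + t + 1 + k)) →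
      u (i + t) = u' (i' + t) := fun t ht h =>
    Letter.eq_of_a_iff ⟨hu'.left_aux h (hF t ht),
      hu.left_aux (fun k hk => (h k hk).symm) (hF t ht).symm⟩
  have hright : ∀ t < n, (∀ k < l, u (i + t + k) = u' (i' + t + k)) →
      u (i + t + l) = u' (i' + t + l) := fun t ht h =>
    Letter.eq_of_a_iff ⟨hu'.right_aux h (hF t ht),
      hu.right_aux (fun k hk => (h k hk).symm) (hF t ht).symm⟩
  have hup : ∀ t, t₀ ≤ t → t ≤ n → ∀ k < l, u (i + t + k) = u' (i' + t + k) := by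
    intro t ht
    induction t, ht using Nat.le_induction with
    | base => exact fun _ => hblock
    | succ t _ ih =>
      intro htn k hk
      have ih' := ih (by omega)
      have e : ∀ x, x + (t + 1) + k = x + t + (k + 1) := fun x => by omega
      rw [e, e]
      rcases (Nat.succ_le_of_lt hk).lt_or_eq with h | h
      · exact ih' _ h
      · rw [← Nat.succ_eq_add_one, h]
        exact hright t (by omega) ih'
  have hdown : ∀ d ≤ t₀, ∀ k < l, u (i + (t₀ - d) + k) = u' (i' + (t₀ - d) + k) := by
    intro d
    induction d with
    | zero => exact fun _ => hblock
    | succ d ih =>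
      intro hd k hk
      have e : ∀ x, x + (t₀ - d) = x + (t₀ - (d + 1)) + 1 := fun x => by omega
      have ih' := ih (by omega)
      rw [e, e] at ih'
      rcases k with _ | k
      · exact hleft _ (by omega) ih'
      · have := ih' k (by omega)
        rwa [Nat.add_assoc, Nat.add_comm 1, Nat.add_assoc (i' + _), Nat.add_comm 1] at this
  have hall : ∀ t ≤ n, ∀ k < l, u (i + t + k) = u' (i' + t + k) := by
    intro t ht
    rcases le_total t₀ t with h | h
    · exact hup t h ht
    · have := hdown (t₀ - t) (by omega)
      rwa [Nat.sub_sub_self h] at this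
  intro m hm
  rcases lt_or_ge m n with h | h
  · exact hleft m h (hall (m + 1) h)
  · have := hall n le_rfl (m - n) (by omega)
    rwa [Nat.add_assoc, Nat.add_sub_cancel' h, Nat.add_assoc, Nat.add_sub_cancel' h] at this

end Separated

/-- All that is needed of the block form: the spacing, and one occurrence of b, which later forces
k₀ ≥ 1. -/
theorem HasBlockForm.separated {v : InfWord Letter} {l₀ l : ℕ} {ε : ℕ → Fin 2}
    (h : HasBlockForm v l₀ l ε) : Separated l v ∧ v l₀ = Letter.b := by
  set W : ℕ → List Letter := fun N => letterPow Letter.a l₀ ++ [Letter.b] ++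
      (List.range N).flatMap (fun i => letterPow Letter.a (l + (ε i : ℕ)) ++ [Letter.b]) with hW
  have hWs : ∀ N, W (N + 1) = W N ++ (letterPow Letter.a (l + (ε N : ℕ)) ++ [Letter.b]) := by
    intro N
    simp [hW, List.range_succ]
  have hWv : ∀ N j (hj : j < (W N).length), (W N)[j] = v j := by
    intro N j hj
    have := (eq_window_iff rfl).1 (h N) j hj
    rwa [Nat.zero_add] at this
  have hW0 : (W 0).length = l₀ + 1 := by simp [hW, letterPow]
  have hlen : ∀ N, (W (N + 1)).length = (W N).length + (l + ε N) + 1 := by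
    intro N
    rw [hWs]; simp [letterPow, Nat.add_assoc]
  have hblock : ∀ N j, j < l + ε N → v ((W N).length + j) = Letter.a := by
    intro N j hj
    rw [← hWv (N + 1) _ (by rw [hlen]; omega)]
    simp only [hWs]
    rw [List.getElem_append_right (by omega), List.getElem_append_left (by simp [letterPow]; omega)]
    simp [letterPow]
  have hzero : ∀ j < l₀, v j = Letter.a := by
    intro j hj
    rw [← hWv 0 j (by omega)]
    simp [hW, letterPow, hj]
  have hl₀ : v l₀ = Letter.b := by
    rw [← hWv 0 l₀ (by omega)]
    simp [hW, letterPow]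
  have hsep : ∀ N i j, j < (W N).length → i < j → v i = Letter.b → v j = Letter.b →
      i + l < j := by
    intro N
    induction N with
    | zero =>
      intro i j hj hij hi _
      rw [hzero i (by omega)] at hi
      cases hi
    | succ N ih =>
      intro i j hj hij hi hjb
      rcases lt_or_ge j (W N).length with hlt | hge
      · exact ih i j hlt hij hi hjb
      · rw [hlen] at hj
        have hj' : ¬ j - (W N).length < l + ε N := fun h' => by
          have := hblock N _ h'
          rw [Nat.add_sub_cancel' hge, hjb] at this
          cases this
        have hi' : i < (W N).length := by
          by_contra hge'
          have := hblock N (i - (W N).length) (by omega)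
          rw [Nat.add_sub_cancel' (by omega), hi] at this
          cases this
        omega
  have hgrow : ∀ N, N < (W N).length := by
    intro N
    induction N with
    | zero => omega
    | succ N ih => rw [hlen]; omega
  exact ⟨fun i j => hsep j i j (hgrow j), hl₀⟩

/-! ### The periodic word -/

theorem periodicWord_eq_b_iff {l j : ℕ} : periodicWord l j = Letter.b ↔ (l + 1) ∣ j + 1 := by
  unfold periodicWord; split_ifs <;> simp_all

theorem periodicWord_eq_a_iff {l j : ℕ} : periodicWord l j = Letter.a ↔ ¬ (l + 1) ∣ j + 1 := by
  unfold periodicWord; split_ifs <;> simp_all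

theorem periodicWord_add_mul (l j k : ℕ) :
    periodicWord l (k * (l + 1) + j) = periodicWord l j := by
  apply Letter.eq_of_a_iff
  rw [periodicWord_eq_a_iff, periodicWord_eq_a_iff, Nat.add_assoc, Nat.dvd_add_right (Dvd.intro_left k rfl)]

theorem separated_periodicWord (l : ℕ) : Separated l (periodicWord l) := by
  intro i j hij hi hj
  rw [periodicWord_eq_b_iff] at hi hj
  have := Nat.le_of_dvd (by omega) (Nat.dvd_sub hj hi)
  omega

theorem periodicWord_eq_a {l j : ℕ} (h : j < l) : periodicWord l j = Letter.a := by
  rw [periodicWord_eq_a_iff]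
  intro h'
  have := Nat.le_of_dvd (by omega) h'
  omega

theorem periodicWord_self (l : ℕ) : periodicWord l l = Letter.b := by
  rw [periodicWord_eq_b_iff]

theorem imageWord_periodicWord (l i : ℕ) : imageWord l (periodicWord l) i = Letter.b := by
  rw [← Letter.ne_a_iff, ne_eq, imageWord_eq_a_iff]
  intro h
  have h1 := Nat.mod_lt i (Nat.succ_pos l)
  apply periodicWord_eq_a_iff.1 (h (l - i % (l + 1)) (by omega))
  refine ⟨i / (l + 1) + 1, ?_⟩
  have := Nat.div_add_mod i (l + 1)
  rw [mul_add]
  simp only [Nat.succ_eq_add_one] at h1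
  omega

theorem wordPow_eq_window (l k : ℕ) :
    wordPow (letterPow Letter.a l ++ [Letter.b]) k = window (periodicWord l) 0 (k * (l + 1)) := by
  induction k with
  | zero => simp [wordPow, window]
  | succ k ih =>
    have h1 : wordPow (letterPow Letter.a l ++ [Letter.b]) (k + 1) =
        wordPow (letterPow Letter.a l ++ [Letter.b]) k ++ (letterPow Letter.a l ++ [Letter.b]) := by
      simp [wordPow, List.replicate_succ']
    rw [h1, ih, Nat.succ_mul, window_add, Nat.zero_add, window_succ, periodicWord_add_mul,
      periodicWord_self]
    congr 2
    rw [eq_window_iff (by simp [letterPow])]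
    intro j hj
    rw [periodicWord_add_mul, periodicWord_eq_a (by simpa [letterPow] using hj)]
    simp [letterPow]

/-- With positions counted from 1, b sits at the multiples of l + 1, and mirror positions add up to
2t + n + (l + 1). -/
theorem reverse_window_periodicWord_iff {l t n : ℕ} (ht : t ≤ l) :
    (window (periodicWord l) t (n + l)).reverse = window (periodicWord l) t (n + l) ↔
      (l + 1) ∣ 2 * t + n := by
  rw [window_reverse_eq_window_iff]
  have hsum : ∀ j < n + l, (t + (n + l - 1 - j) + 1) + (t + j + 1) = (2 * t + n) + (l + 1) := by
    intro j hj; omega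
  constructor
  · intro h
    by_cases hb : l - t < n + l
    · have h1 := h (l - t) hb
      have h2 : periodicWord l (t + (l - t)) = Letter.b := by
        rw [Nat.add_sub_cancel' ht, periodicWord_self]
      rw [h2] at h1
      rw [periodicWord_eq_b_iff] at h1 h2
      have h3 := dvd_add h1 h2
      rw [hsum _ hb] at h3
      exact (Nat.dvd_add_left (dvd_refl _)).1 h3
    · have : 2 * t + n = 0 := by omega
      simp [this]
  · intro h j hj
    apply Letter.eq_of_a_iff
    rw [periodicWord_eq_a_iff, periodicWord_eq_a_iff, not_iff_not]
    have h1 : (l + 1) ∣ (t + (n + l - 1 - j) + 1) + (t + j + 1) := by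
      rw [hsum j hj]; exact dvd_add h (dvd_refl _)
    exact ⟨fun h2 => (Nat.dvd_add_right h2).1 h1, fun h2 => (Nat.dvd_add_left h2).1 h1⟩

theorem window_periodicWord_injOn (l n : ℕ) :
    Set.InjOn (fun t => window (periodicWord l) t (n + l)) (Set.Iic l) := by
  have key : ∀ t t', t < t' → t' ≤ l →
      window (periodicWord l) t (n + l) ≠ window (periodicWord l) t' (n + l) := by
    intro t t' htt' ht' h
    have h1 := window_eq_window_iff.1 h (l - t') (by omega)
    rw [Nat.add_sub_cancel' ht', periodicWord_self, periodicWord_eq_b_iff] at h1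
    have := Nat.le_of_dvd (by omega) h1
    omega
  intro t ht t' ht' h
  by_contra hne
  rcases lt_or_gt_of_ne hne with hlt | hlt
  · exact key t t' hlt ht' h
  · exact key t' t hlt ht h.symm


/-! ### Maximal powers of `a^l b` in a Sturmian word -/

namespace IsSturmian

variable {v : InfWord Letter} {l : ℕ}

/-- The bound on t + m makes the window contain the b at index l, and this b forces any t letters
preceding the window to be a. -/
theorem isFactor_window_periodicWord_zero (hv : IsSturmian v) (hs : Separated l v) {t m : ℕ}
    (ht : t ≤ l) (hm : l < t + m) (h : IsFactor (window (periodicWord l) t m) v) :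
    IsFactor (window (periodicWord l) 0 (t + m)) v := by
  obtain ⟨x, hx, h⟩ := hv.exists_append h t
  obtain ⟨i, -, h⟩ := isFactor_append.1 h
  rw [hx, length_window, window_eq_window_iff] at h
  have hb : v (i + l) = Letter.b := by
    have := h (l - t) (by omega)
    rw [Nat.add_sub_cancel' ht, periodicWord_self, Nat.add_assoc, Nat.add_sub_cancel' ht] at this
    exact this.symm
  refine ⟨i, ?_⟩
  rw [length_window, window_eq_window_iff]
  intro j hj
  rw [Nat.zero_add]
  rcases lt_or_ge j t with hjt | hjt
  · rw [periodicWord_eq_a (by omega), hs.eq_a hb (by omega) (by omega) (by omega)]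
  · have := h (j - t) (by omega)
    rwa [Nat.add_sub_cancel' hjt, Nat.add_assoc, Nat.add_sub_cancel' hjt] at this

/-- The last b of (a^l b)^k₀ is followed by a^l for free; this requires k₀ ≥ 1. -/
theorem isFactor_window_periodicWord (hv : IsSturmian v) (hs : Separated l v) {i₀ k₀ : ℕ}
    (hb : v i₀ = Letter.b) (hk₀ : IsMaxBlockPower v l k₀) :
    IsFactor (window (periodicWord l) 0 (k₀ * (l + 1) + l)) v := by
  have hpos : 1 ≤ k₀ := by
    apply hk₀.2
    rw [Set.mem_ofPred_eq, wordPow_eq_window]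
    have h1 : IsFactor (window (periodicWord l) l 1) v :=
      ⟨i₀, by rw [length_window, window_eq_window_iff]; intro j hj; simp_all [periodicWord_self]⟩
    have := hv.isFactor_window_periodicWord_zero hs le_rfl (by omega) h1
    rwa [Nat.add_comm, ← Nat.one_mul (1 + l), Nat.add_comm 1 l] at this
  have hmem := hk₀.1
  rw [Set.mem_ofPred_eq, wordPow_eq_window] at hmem
  obtain ⟨i, hi⟩ := hmem
  rw [length_window, window_eq_window_iff] at hi
  refine ⟨i, ?_⟩
  obtain ⟨k, rfl⟩ := Nat.exists_eq_add_of_le' hpos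
  rw [length_window, window_eq_window_iff]
  intro j hj
  have hlen : (k + 1) * (l + 1) = k * (l + 1) + l + 1 := by ring
  rcases lt_or_ge j ((k + 1) * (l + 1)) with hlt | hge
  · exact hi j hlt
  · obtain ⟨d, rfl⟩ := Nat.exists_eq_add_of_le hge
    have h1 := hi (k * (l + 1) + l) (by omega)
    rw [Nat.zero_add, periodicWord_add_mul, periodicWord_self] at h1
    rw [hs.eq_a h1.symm (by omega) (by omega) (by omega), Nat.zero_add, periodicWord_add_mul,
      periodicWord_eq_a (by omega)]

theorem add_le_of_isFactor_window_periodicWord (hv : IsSturmian v) (hs : Separated l v)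
    {k₀ : ℕ} (hk₀ : IsMaxBlockPower v l k₀) {t n : ℕ} (ht : t ≤ l)
    (h : IsFactor (window (periodicWord l) t (n + l)) v) : t + n ≤ k₀ * (l + 1) := by
  by_contra! hlt
  have h1 := hv.isFactor_window_periodicWord_zero hs ht (by omega) h
  have : k₀ + 1 ≤ k₀ := by
    apply hk₀.2
    rw [Set.mem_ofPred_eq, wordPow_eq_window]
    have hlen : (k₀ + 1) * (l + 1) = k₀ * (l + 1) + l + 1 := by ring
    have h2 : t + (n + l) = (k₀ + 1) * (l + 1) + (t + n - k₀ * (l + 1) - 1) := by omega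
    rw [h2, window_add] at h1
    exact h1.of_append_left
  omega

end IsSturmian

theorem Separated.exists_window_eq {l : ℕ} {v : InfWord Letter} (hs : Separated l v) {i n : ℕ}
    (h : ∀ j < n, imageWord l v (i + j) = Letter.b) :
    ∃ t ≤ l, window v i (n + l) = window (periodicWord l) t (n + l) := by
  obtain ⟨s, hsl, hblock⟩ : ∃ s ≤ l, ∀ k < l, v (i + k) = Letter.b ↔ k = s := by
    by_cases hb : ∃ s < l, v (i + s) = Letter.b
    · obtain ⟨s, hsl, hb⟩ := hb
      refine ⟨s, hsl.le, fun k hk => ⟨fun hk' => ?_, fun hk' => hk' ▸ hb⟩⟩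
      by_contra hne
      rw [hs.eq_a hb (by omega) (by omega) (by omega)] at hk'
      cases hk'
    · push Not at hb
      exact ⟨l, le_rfl, fun k hk => ⟨fun h' => (hb k hk h').elim, fun h' => by omega⟩⟩
  -- The first block has at most one b, at index s (s = l if there is none); the phase puts the b at
  -- index l of the periodic word there.
  refine ⟨l - s, by omega, ?_⟩
  rw [window_eq_window_iff]
  apply hs.eq_of_imageWord_eq (separated_periodicWord l) (t₀ := 0) _ (Nat.zero_le _)
  · intro k hk
    apply Letter.eq_of_a_iff
    rw [← not_iff_not, ← ne_eq, ← ne_eq, Letter.ne_a_iff, Letter.ne_a_iff, Nat.add_zero,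
      hblock k hk, periodicWord_eq_b_iff, Nat.add_zero]
    constructor
    · rintro rfl
      exact ⟨1, by omega⟩
    · rintro ⟨c, hc⟩
      have : c = 1 := by
        rcases c with _ | _ | c
        · omega
        · rfl
        · have : (l + 1) * (c + 1 + 1) = (l + 1) * c + l + l + 2 := by ring
          omega
      subst this
      omega
  · intro j hj
    rw [h j hj, imageWord_periodicWord]

/-! ### Palindromic complexity of the image -/

/-- The image of a finite word under the cellular automaton, truncated to length `n`. -/
def imageList (l n : ℕ) (w : List Letter) : List Letter :=
  window (imageWord l fun i => w.getD i Letter.b) 0 n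

/-- The default letter in `imageList` is never read: n image letters depend on exactly n + l
letters. -/
theorem imageList_window (l n i : ℕ) (v : InfWord Letter) :
    imageList l n (window v i (n + l)) = window (imageWord l v) i n := by
  rw [imageList, window_eq_window_iff]
  intro j hj
  apply imageWord_eq_imageWord
  intro k hk
  rw [List.getD_eq_getElem _ _ (by simp; omega), getElem_window, Nat.zero_add, Nat.add_assoc]

theorem imageList_reverse_window (l n i : ℕ) (v : InfWord Letter) :
    imageList l n (window v i (n + l)).reverse = (window (imageWord l v) i n).reverse := by
  symm
  rw [imageList, window_reverse_eq_window_iff]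
  intro j hj
  have key : ∀ k ≤ l, ((window v i (n + l)).reverse).getD (0 + j + k) Letter.b =
      v (i + (n - 1 - j) + (l - k)) := by
    intro k hk
    rw [List.getD_eq_getElem _ _ (by simp; omega), List.getElem_reverse, getElem_window,
      length_window]
    congr 1
    omega
  apply Letter.eq_of_a_iff
  rw [imageWord_eq_a_iff, imageWord_eq_a_iff]
  constructor
  · intro h k hk
    rw [key k hk]
    exact h _ (Nat.sub_le _ _)
  · intro h k hk
    have := h (l - k) (Nat.sub_le _ _)
    rwa [key _ (Nat.sub_le _ _), Nat.sub_sub_self hk] at this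

/-- Palindromic factors of length `n`. -/
def palFactors {A : Type} (u : InfWord A) (n : ℕ) : Set (List A) :=
  {w | w ∈ factors u n ∧ w.reverse = w}

theorem finite_palFactors (u : InfWord Letter) (n : ℕ) : (palFactors u n).Finite :=
  (List.finite_length_eq Letter n).subset fun _ h => (mem_factors_iff.1 h.1).2

theorem window_eq_replicate_iff {u : InfWord Letter} {i n : ℕ} {c : Letter} :
    window u i n = List.replicate n c ↔ ∀ j < n, u (i + j) = c := by
  rw [List.eq_replicate_iff]
  simp [window]

theorem Separated.window_eq_of_imageList_eq {l : ℕ} {v : InfWord Letter} (hs : Separated l v)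
    {i i' n : ℕ}
    (h : imageList l n (window v i (n + l)) = imageList l n (window v i' (n + l)))
    (hne : imageList l n (window v i (n + l)) ≠ List.replicate n Letter.b) :
    window v i (n + l) = window v i' (n + l) := by
  rw [imageList_window, imageList_window, window_eq_window_iff] at h
  rw [imageList_window, ne_eq, window_eq_replicate_iff] at hne
  push Not at hne
  obtain ⟨t, ht, hne⟩ := hne
  have ha : imageWord l v (i + t) = Letter.a := by
    by_contra h'
    exact hne (Letter.ne_a_iff.1 h')
  have ha' := ha
  rw [h t ht] at ha'
  rw [imageWord_eq_a_iff] at ha ha'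
  rw [window_eq_window_iff]
  exact hs.eq_of_imageWord_eq hs h ht.le fun k hk => by rw [ha k hk.le, ha' k hk.le]

theorem IsSturmian.palComplexity_imageWord {v : InfWord Letter} {l i₀ k₀ : ℕ}
    (hv : IsSturmian v) (hs : Separated l v) (hb : v i₀ = Letter.b)
    (hk₀ : IsMaxBlockPower v l k₀) (n : ℕ) :
    palComplexity (imageWord l v) n +
        {t | t ≤ l ∧ t + n ≤ k₀ * (l + 1) ∧ (l + 1) ∣ 2 * t + n}.ncard =
      palComplexity v (n + l) + if n ≤ k₀ * (l + 1) then 1 else 0 := by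
  set bn : List Letter := List.replicate n Letter.b with hbn
  set T : Set ℕ := {t | t ≤ l ∧ t + n ≤ k₀ * (l + 1) ∧ (l + 1) ∣ 2 * t + n} with hT
  have hper : ∀ t, imageList l n (window (periodicWord l) t (n + l)) = bn := fun t => by
    rw [imageList_window, window_eq_replicate_iff]
    exact fun j _ => imageWord_periodicWord l _
  have hfac : ∀ t, t + n ≤ k₀ * (l + 1) → IsFactor (window (periodicWord l) t (n + l)) v := by
    intro t ht
    have := hv.isFactor_window_periodicWord hs hb hk₀
    have hlen : k₀ * (l + 1) + l = t + (n + l) + (k₀ * (l + 1) - (t + n)) := by omega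
    rw [hlen, window_add, window_add, Nat.zero_add] at this
    exact this.of_append_left.of_append_right
  have hinv : ∀ i, imageList l n (window v i (n + l)) = bn → ∃ t ≤ l, t + n ≤ k₀ * (l + 1) ∧
      window v i (n + l) = window (periodicWord l) t (n + l) := by
    intro i hi
    rw [imageList_window, window_eq_replicate_iff] at hi
    obtain ⟨t, ht, h⟩ := hs.exists_window_eq hi
    refine ⟨t, ht, ?_, h⟩
    exact hv.add_le_of_isFactor_window_periodicWord hs hk₀ ht (h ▸ isFactor_window v i _)
  have hB : {u | u ∈ palFactors v (n + l) ∧ imageList l n u = bn} =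
      (fun t => window (periodicWord l) t (n + l)) '' T := by
    ext u
    constructor
    · rintro ⟨⟨⟨i, rfl⟩, hpal⟩, hi⟩
      obtain ⟨t, ht, h1, h2⟩ := hinv i hi
      rw [h2, reverse_window_periodicWord_iff ht] at hpal
      exact ⟨t, ⟨ht, h1, hpal⟩, h2.symm⟩
    · rintro ⟨t, ⟨ht, h1, h2⟩, rfl⟩
      exact ⟨⟨mem_factors_iff.2 ⟨hfac t h1, by simp⟩, (reverse_window_periodicWord_iff ht).2 h2⟩,
        hper t⟩
  have hBcard : {u | u ∈ palFactors v (n + l) ∧ imageList l n u = bn}.ncard = T.ncard := by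
    rw [hB]
    exact ((window_periodicWord_injOn l n).mono fun t ht => ht.1).ncard_image
  have hA : imageList l n '' {u | u ∈ palFactors v (n + l) ∧ ¬ imageList l n u = bn} =
      palFactors (imageWord l v) n \ {bn} := by
    ext w
    constructor
    · rintro ⟨u, ⟨⟨⟨i, rfl⟩, hpal⟩, hne⟩, rfl⟩
      refine ⟨⟨⟨i, imageList_window _ _ _ _⟩, ?_⟩, hne⟩
      rw [imageList_window, ← imageList_reverse_window, hpal, imageList_window]
    · rintro ⟨⟨⟨i, rfl⟩, hpal⟩, hne⟩
      refine ⟨window v i (n + l), ⟨⟨⟨i, rfl⟩, ?_⟩, ?_⟩, imageList_window _ _ _ _⟩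
      -- The reversed window is again a factor with the same palindromic image, which contains an a,
      -- so uniqueness of the preimage makes the window a palindrome.
      · obtain ⟨i', hi'⟩ := hv.isFactor_reverse (isFactor_window v i (n + l))
        rw [List.length_reverse, length_window] at hi'
        rw [hi']
        symm
        apply hs.window_eq_of_imageList_eq
        · rw [← hi', imageList_reverse_window, hpal, imageList_window]
        · rw [imageList_window]; exact hne
      · rw [imageList_window]; exact hne
  have hAcard : {u | u ∈ palFactors v (n + l) ∧ ¬ imageList l n u = bn}.ncard =
      (palFactors (imageWord l v) n \ {bn}).ncard := by
    rw [← hA]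
    refine (Set.InjOn.ncard_image ?_).symm
    rintro _ ⟨⟨⟨i, rfl⟩, -⟩, hne⟩ _ ⟨⟨⟨i', rfl⟩, -⟩, -⟩ h
    exact hs.window_eq_of_imageList_eq h hne
  have hmem : bn ∈ palFactors (imageWord l v) n ↔ n ≤ k₀ * (l + 1) := by
    constructor
    · rintro ⟨⟨i, hi⟩, -⟩
      obtain ⟨t, -, h, -⟩ := hinv i (by rw [imageList_window, hi])
      omega
    · intro hn
      obtain ⟨i, hi⟩ := hfac 0 (by omega)
      rw [length_window] at hi
      refine ⟨⟨i, ?_⟩, by simp [hbn]⟩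
      rw [← hper 0, hi, imageList_window]
  have hsplit : palComplexity v (n + l) =
      {u | u ∈ palFactors v (n + l) ∧ imageList l n u = bn}.ncard +
        {u | u ∈ palFactors v (n + l) ∧ ¬ imageList l n u = bn}.ncard := by
    have hfin := finite_palFactors v (n + l)
    rw [← Set.ncard_union_eq _ (hfin.subset fun _ h => h.1) (hfin.subset fun _ h => h.1)]
    · change (palFactors v (n + l)).ncard = _
      congr 1
      ext u
      simp only [Set.mem_union, Set.mem_ofPred_eq]
      tauto
    · rw [Set.disjoint_left]
      exact fun u h h' => h'.2 h.2
  rw [hsplit, hBcard, hAcard]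
  change (palFactors (imageWord l v) n).ncard + _ = _
  split_ifs with hn
  · rw [← Set.ncard_sdiff_singleton_add_one (hmem.2 hn) (finite_palFactors _ _)]
    omega
  · rw [Set.sdiff_singleton_eq_self (mt hmem.1 hn)]
    omega

/-! ### Counting the palindromic windows of the periodic word -/

theorem ncard_palindromic_phases {l k₀ n : ℕ} (h : n + l ≤ k₀ * (l + 1)) :
    {t | t ≤ l ∧ t + n ≤ k₀ * (l + 1) ∧ (l + 1) ∣ 2 * t + n}.ncard =
      if Even l then 1 else if Even n then 2 else 0 := by
  have hr := Nat.mod_lt n (Nat.succ_pos l)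
  have hmod : ∀ t, (l + 1) ∣ 2 * t + n ↔ (l + 1) ∣ 2 * t + n % (l + 1) := fun t => by
    conv_lhs => rw [← Nat.mod_add_div n (l + 1), ← Nat.add_assoc]
    exact Nat.dvd_add_left (Nat.dvd_mul_right _ _)
  have hpar : Odd l → (Even n ↔ Even (n % (l + 1))) := fun hl => by
    conv_lhs => rw [← Nat.mod_add_div n (l + 1)]
    have : Even (l + 1) := hl.add_one
    simp [Nat.even_add, this]
  -- With n reduced mod l + 1 the sum stays below 3(l + 1), leaving three possible multiples.
  have hset : {t | t ≤ l ∧ t + n ≤ k₀ * (l + 1) ∧ (l + 1) ∣ 2 * t + n} =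
      {t | t ≤ l ∧ (2 * t + n % (l + 1) = 0 ∨ 2 * t + n % (l + 1) = l + 1 ∨
        2 * t + n % (l + 1) = 2 * (l + 1))} := by
    ext t
    simp only [Set.mem_ofPred_eq, hmod]
    constructor
    · rintro ⟨h1, -, c, hc⟩
      refine ⟨h1, ?_⟩
      rcases c with _ | _ | _ | c
      · omega
      · omega
      · omega
      · have : (l + 1) * (c + 1 + 1 + 1) = (l + 1) * c + 3 * (l + 1) := by ring
        simp only [Nat.succ_eq_add_one] at hr
        omega
    · rintro ⟨h1, h2⟩
      refine ⟨h1, by omega, ?_⟩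
      rcases h2 with h2 | h2 | h2 <;> rw [h2]
      · exact dvd_zero _
      · exact Dvd.intro_left 2 rfl
  rw [hset]
  simp only [Nat.succ_eq_add_one] at hr
  generalize n % (l + 1) = r at *
  split_ifs with hl hn
  · rw [Set.ncard_eq_one]
    obtain ⟨m, hm⟩ := hl
    refine ⟨if r = 0 then 0 else if Even r then l + 1 - r / 2 else (l + 1 - r) / 2, ?_⟩
    ext t
    simp only [Set.mem_ofPred_eq, Set.mem_singleton_iff, Nat.even_iff]
    split_ifs <;> omega
  · rw [Nat.not_even_iff_odd] at hl
    rw [hpar hl] at hn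
    obtain ⟨m, hm⟩ := hl
    obtain ⟨s, hs⟩ := hn
    rw [Set.ncard_eq_two]
    -- Here r = 2s and l + 1 = 2(m + 1); for r = 0 the first solution l + 1 is out of range and
    -- wraps to 0.
    refine ⟨if r = 0 then 0 else l + 1 - s, m + 1 - s, ?_, ?_⟩
    · split_ifs <;> omega
    · ext t
      simp only [Set.mem_ofPred_eq, Set.mem_insert_iff, Set.mem_singleton_iff]
      split_ifs <;> omega
  · rw [Nat.not_even_iff_odd] at hl
    rw [hpar hl, Nat.not_even_iff_odd] at hn
    obtain ⟨m, hm⟩ := hl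
    obtain ⟨s, hs⟩ := hn
    rw [Set.ncard_eq_zero ((Set.finite_Iic l).subset fun t ht => ht.1), Set.eq_empty_iff_forall_notMem]
    rintro t ⟨-, ht⟩
    omega

theorem ncard_palindromic_phases_of_lt {l k₀ n : ℕ} (h : k₀ * (l + 1) < n + l)
    (hn : n ≤ k₀ * (l + 1)) :
    {t | t ≤ l ∧ t + n ≤ k₀ * (l + 1) ∧ (l + 1) ∣ 2 * t + n}.ncard =
      if Even (k₀ * (l + 1) + n) then 1 else 0 := by
  have hset : {t | t ≤ l ∧ t + n ≤ k₀ * (l + 1) ∧ (l + 1) ∣ 2 * t + n} =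
      {t | 2 * t + n = k₀ * (l + 1)} := by
    ext t
    simp only [Set.mem_ofPred_eq]
    constructor
    · rintro ⟨-, h2, c, hc⟩
      rw [Nat.mul_comm (l + 1)] at hc
      -- The bounds n₀ - l < n ≤ 2t + n ≤ n₀ + t ≤ n₀ + l leave n₀ as the only multiple of l + 1.
      rcases lt_trichotomy c k₀ with hlt | rfl | hlt
      · have := Nat.mul_le_mul_right (l + 1) (Nat.succ_le_of_lt hlt)
        rw [Nat.succ_mul] at this
        omega
      · exact hc
      · have := Nat.mul_le_mul_right (l + 1) (Nat.succ_le_of_lt hlt)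
        rw [Nat.succ_mul] at this
        omega
    · intro ht
      exact ⟨by omega, by omega, ht ▸ Dvd.intro_left _ rfl⟩
  rw [hset]
  generalize k₀ * (l + 1) = n₀ at *
  split_ifs with he
  · rw [Set.ncard_eq_one]
    refine ⟨(n₀ - n) / 2, ?_⟩
    rw [Nat.even_iff] at he
    ext t
    simp only [Set.mem_ofPred_eq, Set.mem_singleton_iff]
    omega
  · rw [Nat.even_iff] at he
    have : {t | 2 * t + n = n₀} = ∅ := by
      ext t
      simp only [Set.mem_ofPred_eq, Set.mem_empty_iff_false, iff_false]
      omega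
    rw [this, Set.ncard_empty]

theorem ncard_palindromic_phases_of_gt {l k₀ n : ℕ} (h : k₀ * (l + 1) < n) :
    {t | t ≤ l ∧ t + n ≤ k₀ * (l + 1) ∧ (l + 1) ∣ 2 * t + n}.ncard = 0 := by
  have : {t | t ≤ l ∧ t + n ≤ k₀ * (l + 1) ∧ (l + 1) ∣ 2 * t + n} = ∅ := by
    ext t
    simp only [Set.mem_ofPred_eq, Set.mem_empty_iff_false, iff_false]
    omega
  rw [this, Set.ncard_empty]

end SturmianCA

theorem mainTheorem2 (v : SturmianCA.InfWord SturmianCA.Letter)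
    (hv : SturmianCA.IsSturmian v)
    (l₀ l : ℕ) (ε : ℕ → Fin 2) (hform : SturmianCA.HasBlockForm v l₀ l ε)
    (k₀ n₀ : ℕ) (hk₀ : SturmianCA.IsMaxBlockPower v l k₀) (hn₀ : n₀ = k₀ * (l + 1))
    (n : ℕ) :
    (n + l ≤ n₀ →
      SturmianCA.palComplexity (SturmianCA.imageWord l v) n = if Even n then 1 else 2) ∧
    (n₀ < n + l → n ≤ n₀ →
      SturmianCA.palComplexity (SturmianCA.imageWord l v) n =
        if Even n₀ then
          (if Even l ∧ Even n then 1 else if Odd l then 2 else 3)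
        else 2) ∧
    (n₀ < n →
      SturmianCA.palComplexity (SturmianCA.imageWord l v) n =
        if Even (n + l) then 1 else 2) := by
  obtain ⟨hs, hb⟩ := hform.separated
  have key := hv.palComplexity_imageWord hs hb hk₀ n
  rw [hv.palComplexity_eq] at key
  refine ⟨fun h => ?_, fun h h' => ?_, fun h => ?_⟩
  · have hn : n ≤ k₀ * (l + 1) := by omega
    rw [SturmianCA.ncard_palindromic_phases (hn₀ ▸ h), if_pos hn] at key
    simp only [Nat.even_iff] at key ⊢
    split_ifs at key ⊢ <;> omega
  · have hn : n ≤ k₀ * (l + 1) := by omega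
    -- This excludes l and n₀ both odd, so for n₀ odd l is even.
    have hpar : Odd l → Even n₀ := fun hl => hn₀ ▸ hl.add_one.mul_left k₀
    rw [SturmianCA.ncard_palindromic_phases_of_lt (hn₀ ▸ h) hn, ← hn₀, if_pos h'] at key
    simp only [Nat.even_iff, Nat.odd_iff] at key hpar ⊢
    split_ifs at key ⊢ <;> omega
  · have hn : ¬ n ≤ k₀ * (l + 1) := by omega
    rw [SturmianCA.ncard_palindromic_phases_of_gt (hn₀ ▸ h), if_neg hn] at key
    simpa using key
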